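/- \textbf{Setup.} An \emph{order unit space} is a partially ordered real vector space $V$ with an element $e$ such that every $a\in V$ satisfies $a\le re$ for some $r\in\mathbb R$, and such that $a\le re$ for all $r>0$ implies $a\le 0$. Put $\|a\|=\inf\{r\in\mathbb R: -re\le a\le re\}$. Its state space $S(V)$ consists of the bounded linear functionals $\mu:V\to\mathbb R$ with $\mu(e)=1=\|\mu\|'$, where $\|\cdot\|'$ is the dual norm. A \emph{Lip norm} on $V$ is a seminorm $L$ on $V$ with $L(a)=0\iff a\in\mathbb Re$, such that the topology on $S(V)$ given by the (a priori extended-valued) metric $\rho_L(\mu,\lambda)=\sup\{|\mu(a)-\lambda(a)|:L(a)\le1\}$ is the weak-$*$ topology. Then $(V,L)$ is called a \emph{compact quantum metric space} (CQMS). Real linear subspaces of the self-adjoint part of a unital $C^*$-algebra that contain the unit $1$ carry the inherited order and the order unit $e=1$. Let $\mathcal A$ be a unital $C^*$-algebra, faithfully and unitally represented on a complex Hilbert space $\mathcal H$, let $\mathrm{Lip}(\mathcal A)$ be a dense real linear subspace of the self-adjoint part $\mathcal A_{s.a.}$ with $1\in\mathrm{Lip}(\mathcal A)$, let $L$ be a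 Lip norm on $\mathrm{Lip}(\mathcal A)$, and let $\nu$ be a state of $\mathcal A$. Let $\mathcal K$ be the algebra of compact operators on $\ell^2(\mathbb N)$, $\mathbb N=\{1,2,\dots\}$, and let $\mathcal K\otimes\mathcal A$ be the (spatial) $C^*$-tensor product acting on $\ell^2(\mathbb N)\otimes\mathcal H$, whose elements are written as matrices $(a_{ij})_{i,j\ge1}$ with entries in $\mathcal A$. Let $\widetilde{\mathcal A}_\nu$ be the set of all $(a_{ij})\in\mathcal K\otimes\mathcal A$ such that $a_{ij}\in\mathrm{Lip}(\mathcal A)$ and $a_{ij}=a_{ji}$ for all $i,j\ge 1$, and $$L_k((a_{ij})):=\sup_{i,j\ge1}(i+j)^k\bigl(L(a_{ij})+|\nu(a_{ij})|\bigr)<\infty\quad\text{for all }k\in\mathbb R.$$ Let $$0\longrightarrow\mathcal K\otimes\mathcal A\xrightarrow{\ i\ }\widetilde{\mathcal A}_1\xrightarrow{\ \pi\ }\widetilde{\mathcal A}_2\longrightarrow0$$ be a short exact sequence of $C^*$-algebras with $\widetilde{\mathcal A}_1,\widetilde{\mathcal A}_2$ unital, and let $\sigma:\widetilde{\mathcal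 A}_2\to\widetilde{\mathcal A}_1$ be a positive unital complex-linear map with $\pi\circ\sigma=\mathrm{id}$. Let $\mathcal A_2$ be a dense real linear subspace of the self-adjoint part of $\widetilde{\mathcal A}_2$ with $1\in\mathcal A_2$, and let $L_2^{\mathcal A_2}$ be a Lip norm on $\mathcal A_2$ (so that $(\mathcal A_2,L_2^{\mathcal A_2})$ is a CQMS; this seminorm is part of the data and is not the case $k=2$ of $L_k$). \textbf{Theorem.} The sum $\mathcal A_1:=i(\widetilde{\mathcal A}_\nu)\oplus\sigma(\mathcal A_2)$ is direct, and it is a real linear subspace of the self-adjoint part of $\widetilde{\mathcal A}_1$ that contains $1$, hence an order unit space. For every $a\in\mathcal A_1$ one has $\pi(a)\in\mathcal A_2$ and $a-\sigma(\pi(a))\in i(\widetilde{\mathcal A}_\nu)$. For every real $k>2$, $$L_1(a)=L_2^{\mathcal A_2}(\pi(a))+L_k\bigl(i^{-1}(a-\sigma(\pi(a)))\bigr),\qquad a\in\mathcal A_1,$$ is a Lip norm on $\mathcal A_1$, so that $(\mathcal A_1,L_1)$ is a compact quantum metric space. -/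

import Mathlib

open scoped ComplexOrder ENNReal

noncomputable section

namespace CQMS

/-! ### Order unit spaces, states, Lip norms -/

section OrderUnit

variable {V : Type*} [AddCommGroup V] [Module ℝ V] [PartialOrder V]

/-- `V` is a partially ordered real vector space and `e` is an Archimedean order unit of it. -/
structure IsOrderUnitSpace (e : V) : Prop where
  add_le_add_left : ∀ a b c : V, a ≤ b → c + a ≤ c + b
  smul_nonneg : ∀ (r : ℝ) (a : V), 0 ≤ r → 0 ≤ a → 0 ≤ r • a
  order_unit : ∀ a : V, ∃ r : ℝ, a ≤ r • e
  archimedean : ∀ a : V, (∀ r : ℝ, 0 < r → a ≤ r • e) → a ≤ 0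

/-- The order unit norm. -/
def ouNorm (e a : V) : ℝ := sInf {r : ℝ | -(r • e) ≤ a ∧ a ≤ r • e}

/-- States of `(V, e)`: linear functionals that are bounded for the order unit norm, have dual norm
`1` (the dual norm being the least bound), and take the value `1` at `e`. -/
structure OUState (e : V) where
  toLinearMap : V →ₗ[ℝ] ℝ
  map_unit : toLinearMap e = 1
  dualNorm_eq_one : IsLeast {c : ℝ | 0 ≤ c ∧ ∀ a : V, |toLinearMap a| ≤ c * ouNorm e a} 1

instance (e : V) : CoeFun (OUState e) (fun _ => V → ℝ) := ⟨fun μ => μ.toLinearMap⟩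

/-- The weak-* topology on the state space: pointwise convergence on `V`. -/
@[reducible]
def weakStarTopology (e : V) : TopologicalSpace (OUState e) :=
  TopologicalSpace.induced (fun (μ : OUState e) (a : V) => μ a) Pi.topologicalSpace

/-- `ρ_L(μ, ν) = sup {|μ(a) - ν(a)| : L(a) ≤ 1}`, with values in `[0, ∞]`. -/
def rho {e : V} (L : Seminorm ℝ V) (μ ν : OUState e) : ℝ≥0∞ :=
  ⨆ (a : V) (_ : L a ≤ 1), ENNReal.ofReal |μ a - ν a|

/-- The state space with the (extended) metric `ρ_L`. -/
@[reducible]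
def rhoMetric (e : V) (L : Seminorm ℝ V) : PseudoEMetricSpace (OUState e) where
  edist := rho L
  edist_self μ := by simp [rho]
  edist_comm μ ν := by simp only [rho, abs_sub_comm]
  edist_triangle μ ν τ := by
    refine iSup₂_le fun a ha => ?_
    refine le_trans ?_ (add_le_add
      (le_iSup₂ (f := fun (a : V) (_ : L a ≤ 1) => ENNReal.ofReal |μ a - ν a|) a ha)
      (le_iSup₂ (f := fun (a : V) (_ : L a ≤ 1) => ENNReal.ofReal |ν a - τ a|) a ha))
    rw [← ENNReal.ofReal_add (abs_nonneg _) (abs_nonneg _)]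
    exact ENNReal.ofReal_le_ofReal (abs_sub_le _ _ _)

/-- Lip norms on an order unit space. -/
structure IsLipNorm (e : V) (L : Seminorm ℝ V) : Prop where
  eq_zero_iff : ∀ a : V, L a = 0 ↔ ∃ r : ℝ, a = r • e
  topology_eq : (rhoMetric e L).toUniformSpace.toTopologicalSpace = weakStarTopology e

/-- Compact quantum metric spaces. -/
structure IsCompactQuantumMetricSpace (e : V) (L : Seminorm ℝ V) : Prop where
  isOrderUnitSpace : IsOrderUnitSpace e
  isLipNorm : IsLipNorm e L

end OrderUnit

/-! ### The C*-algebra `𝒦 ⊗ 𝒜`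

`𝒜` is represented on `H` by `ρ`, and `ℓ²(ℕ) ⊗ H` is realised as `ℓ²(ℕ; H)`. -/

/-- The scalar sequence space `ℓ²(ℕ)`. -/
abbrev SeqL2 : Type := lp (fun _ : ℕ => ℂ) 2

/-- The Hilbert space `ℓ²(ℕ; H)`. -/
abbrev HilbertL2 (H : Type*) [NormedAddCommGroup H] : Type _ := lp (fun _ : ℕ => H) 2

section Stabilization

variable {A H : Type*} [CStarAlgebra A]
  [NormedAddCommGroup H] [InnerProductSpace ℂ H] [CompleteSpace H]

/-- The vector `ξ ⊗ v`, that is, the sequence `(ξ n • v)`. -/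
def tensorVec (ξ : SeqL2) (v : H) : HilbertL2 H :=
  ⟨fun n => ξ n • v, by
    refine memℓp_gen ?_
    have h := (lp.memℓp ξ).summable (by norm_num)
    refine (h.mul_right (‖v‖ ^ (2 : ℝ≥0∞).toReal)).congr fun n => ?_
    rw [norm_smul, Real.mul_rpow (norm_nonneg _) (norm_nonneg _)]⟩

/-- `T` is the operator `c ⊗ ρ(a)`: it maps `ξ ⊗ v` to `(c ξ) ⊗ (ρ(a) v)`. -/
def IsElementaryTensor (ρ : A →⋆ₐ[ℂ] (H →L[ℂ] H)) (c : SeqL2 →L[ℂ] SeqL2) (a : A)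
    (T : HilbertL2 H →L[ℂ] HilbertL2 H) : Prop :=
  ∀ (ξ : SeqL2) (v : H), T (tensorVec ξ v) = tensorVec (c ξ) (ρ a v)

/-- `𝒦 ⊗ 𝒜`: the closed star subalgebra of the bounded operators on `ℓ²(ℕ; H)` generated by all
`c ⊗ ρ(a)` with `c` compact and `a` in `𝒜`. -/
def stabilization (ρ : A →⋆ₐ[ℂ] (H →L[ℂ] H)) :
    NonUnitalStarSubalgebra ℂ (HilbertL2 H →L[ℂ] HilbertL2 H) :=
  (NonUnitalStarAlgebra.adjoin ℂ {T : HilbertL2 H →L[ℂ] HilbertL2 H |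
    ∃ (c : SeqL2 →L[ℂ] SeqL2) (a : A),
      IsCompactOperator c ∧ IsElementaryTensor ρ c a T}).topologicalClosure

instance isClosed_stabilization (ρ : A →⋆ₐ[ℂ] (H →L[ℂ] H)) :
    IsClosed (stabilization ρ : Set (HilbertL2 H →L[ℂ] HilbertL2 H)) :=
  NonUnitalStarSubalgebra.isClosed_topologicalClosure _

instance stabilizationCStarAlgebra (ρ : A →⋆ₐ[ℂ] (H →L[ℂ] H)) :
    NonUnitalCStarAlgebra (stabilization ρ) :=
  NonUnitalStarSubalgebra.nonUnitalCStarAlgebra _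

instance stabilizationRealModule (ρ : A →⋆ₐ[ℂ] (H →L[ℂ] H)) : Module ℝ (stabilization ρ) :=
  Module.complexToReal _

/-- The `(i, j)` matrix entry of the operator `T` is `a`, an element of `𝒜`. -/
def IsEntry (ρ : A →⋆ₐ[ℂ] (H →L[ℂ] H)) (T : HilbertL2 H →L[ℂ] HilbertL2 H) (i j : ℕ) (a : A) :
    Prop :=
  ∀ v : H, T (lp.single 2 j v) i = ρ a v

variable {S : Submodule ℝ A}

/-- The weighted size `(i + j) ^ k (L(a) + |ν(a)|)` of an entry `a` of a matrix.
Rows and columns are numbered from `0` here, so `i + j` becomes `i + j + 2`. -/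
def entryWeight (L : Seminorm ℝ S) (ν : A → ℂ) (k : ℝ) (i j : ℕ) (a : S) : ℝ :=
  ((i : ℝ) + (j : ℝ) + 2) ^ k * (L a + ‖ν (a : A)‖)

/-- The space of all symmetric matrices in `𝒦 ⊗ 𝒜` with entries in the subspace `S` (the Lipschitz
elements) for which `(i + j) ^ k (L(a i j) + |ν(a i j)|)` is bounded for every `k`. -/
def lipMatrices [PartialOrder A] [StarOrderedRing A] (ρ : A →⋆ₐ[ℂ] (H →L[ℂ] H))
    (L : Seminorm ℝ S) (ν : A →ₚ[ℂ] ℂ) : Submodule ℝ (stabilization ρ) where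
  carrier := {x | ∃ a : ℕ → ℕ → S,
    (∀ i j, IsEntry ρ (x : HilbertL2 H →L[ℂ] HilbertL2 H) i j (a i j : A)) ∧
    (∀ i j, a i j = a j i) ∧
    ∀ k : ℝ, BddAbove (Set.range fun p : ℕ × ℕ => entryWeight L ν k p.1 p.2 (a p.1 p.2))}
  zero_mem' := by
    refine ⟨fun _ _ => 0, fun i j v => by simp, fun _ _ => rfl, fun k => ⟨0, ?_⟩⟩
    rintro _ ⟨p, rfl⟩
    simp [entryWeight]
  add_mem' := by
    rintro x y ⟨a, ha, hsa, hba⟩ ⟨b, hb, hsb, hbb⟩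
    refine ⟨fun i j => a i j + b i j, fun i j v => ?_, fun i j => ?_, fun k => ?_⟩
    · have h1 := ha i j v
      have h2 := hb i j v
      simp only [NonUnitalStarSubalgebra.coe_add, add_apply,
        lp.coeFn_add, Pi.add_apply, Submodule.coe_add, map_add, h1, h2]
    · simp only [hsa i j, hsb i j]
    · obtain ⟨M, hM⟩ := hba k
      obtain ⟨N, hN⟩ := hbb k
      refine ⟨M + N, ?_⟩
      rintro _ ⟨p, rfl⟩
      have h1 := hM (Set.mem_range_self p)
      have h2 := hN (Set.mem_range_self p)
      refine le_trans ?_ (add_le_add h1 h2)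
      simp only [entryWeight]
      rw [← mul_add]
      refine mul_le_mul_of_nonneg_left ?_ (by positivity)
      have h3 := map_add_le_add L (a p.1 p.2) (b p.1 p.2)
      have h4 := norm_add_le (ν (a p.1 p.2 : A)) (ν (b p.1 p.2 : A))
      have h5 : ((a p.1 p.2 + b p.1 p.2 : S) : A) = (a p.1 p.2 : A) + (b p.1 p.2 : A) := rfl
      rw [h5, map_add ν]
      linarith
  smul_mem' := by
    rintro r x ⟨a, ha, hsa, hba⟩
    refine ⟨fun i j => r • a i j, fun i j v => ?_, fun i j => ?_, fun k => ?_⟩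
    · have h1 := ha i j v
      have h2 : ((r • x : stabilization ρ) : HilbertL2 H →L[ℂ] HilbertL2 H) =
        (r : ℂ) • (x : HilbertL2 H →L[ℂ] HilbertL2 H) := rfl
      have h3 : ((r • a i j : S) : A) = (r : ℂ) • (a i j : A) := rfl
      rw [h2, h3, map_smul]
      simp only [smul_apply, lp.coeFn_smul, Pi.smul_apply, h1]
    · simp only [hsa i j]
    · obtain ⟨M, hM⟩ := hba k
      refine ⟨|r| * M, ?_⟩
      rintro _ ⟨p, rfl⟩
      have h1 := hM (Set.mem_range_self p)
      refine le_trans (le_of_eq ?_) (mul_le_mul_of_nonneg_left h1 (abs_nonneg r))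
      have h3 : ((r • a p.1 p.2 : S) : A) = (r : ℂ) • (a p.1 p.2 : A) := rfl
      simp only [entryWeight]
      rw [h3, map_smul ν, map_smul_eq_mul L, norm_smul, Complex.norm_real, Real.norm_eq_abs]
      ring

/-- `L_k((a i j)) = sup (i + j) ^ k (L(a i j) + |ν(a i j)|)`. -/
def matrixLip (ρ : A →⋆ₐ[ℂ] (H →L[ℂ] H)) (L : Seminorm ℝ S) (ν : A → ℂ) (k : ℝ)
    (x : stabilization ρ) : ℝ :=
  sSup {r : ℝ | ∃ (i j : ℕ) (a : S),
    IsEntry ρ (x : HilbertL2 H →L[ℂ] HilbertL2 H) i j (a : A) ∧ r = entryWeight L ν k i j a}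

end Stabilization

/-- A short exact sequence `0 → J → E → Q → 0` of C*-algebras, with `E` and `Q` unital, together
with a positive unital linear splitting `σ` of `π`. -/
structure PositiveSplitExtension (J E Q : Type*) [NonUnitalCStarAlgebra J]
    [CStarAlgebra E] [PartialOrder E] [StarOrderedRing E]
    [CStarAlgebra Q] [PartialOrder Q] [StarOrderedRing Q] where
  i : J →⋆ₙₐ[ℂ] E
  π : E →⋆ₙₐ[ℂ] Q
  i_injective : Function.Injective i
  π_surjective : Function.Surjective π
  exact : ∀ a : E, π a = 0 ↔ ∃ x : J, i x = a
  σ : Q →ₚ[ℂ] E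
  σ_one : σ 1 = 1
  π_σ : ∀ b : Q, π (σ b) = b

namespace PositiveSplitExtension

variable {J E Q : Type*} [NonUnitalCStarAlgebra J] [CStarAlgebra E] [PartialOrder E]
  [StarOrderedRing E] [CStarAlgebra Q] [PartialOrder Q] [StarOrderedRing Q]

/-- The image `i(W)` of a real subspace. -/
def iImage [Module ℝ J] [IsScalarTower ℝ ℂ J] (X : PositiveSplitExtension J E Q)
    (W : Submodule ℝ J) : Submodule ℝ E :=
  W.map ((X.i : J →ₗ[ℂ] E).restrictScalars ℝ)

/-- The image `σ(W)` of a real subspace. -/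
def σImage (X : PositiveSplitExtension J E Q) (W : Submodule ℝ Q) : Submodule ℝ E :=
  W.map (X.σ.toLinearMap.restrictScalars ℝ)

/-- The subspace `i(W) + σ(W')`. -/
def sumSpace [Module ℝ J] [IsScalarTower ℝ ℂ J] (X : PositiveSplitExtension J E Q)
    (W : Submodule ℝ J) (W' : Submodule ℝ Q) : Submodule ℝ E :=
  X.iImage W ⊔ X.σImage W'

end PositiveSplitExtension

end CQMS

end

noncomputable section

namespace CQMS

/-! ### Finite discretizations -/

/-! The proof rests on Rieffel's criterion: a seminorm vanishing exactly on the scalars is a Lip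
norm if and only if its unit ball is totally bounded in norm modulo scalars. `IsLipNorm.finDisc`
extracts this from `L` and `L₂`; `isLipNorm_of_finDisc` gives it back for `L₁`.

In between, total boundedness is transported. Since `ν` detects scalars, the ball of `L + |ν|` is
totally bounded in `A` itself (`finDisc_entrySeminorm`). On the ball of `L_k` the entries are
bounded by a multiple of `(i + j) ^ (-k)`, which is summable over pairs exactly when `k > 2`. As the
operator norm is at most the sum of the norms of the entries, the tails are uniformly small and
finitely many entries remain to be discretized (`finDisc_matrixSeminorm`). Finally `a = i(x) + σ(b)`
with `i` contractive and `σ` bounded and unital, so nets for `x` in norm and for `b` modulo scalars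
give one for `a` modulo scalars (`isLipNorm_sumSeminorm`).

Total boundedness is expressed by `FinDisc`, which passes to pullbacks and finite conjunctions
without requiring the net to lie in any prescribed set. -/

/-- Finitely many data determine a point of `s` up to the relation `r`. -/
def FinDisc {V : Type*} (s : Set V) (r : V → V → Prop) : Prop :=
  ∃ (β : Type) (F : V → β), (F '' s).Finite ∧ ∀ a ∈ s, ∀ b ∈ s, F a = F b → r a b

namespace FinDisc

variable {V W : Type*} {s : Set V} {r r' : V → V → Prop}

theorem mono (h : FinDisc s r) (hr : ∀ a ∈ s, ∀ b ∈ s, r a b → r' a b) : FinDisc s r' := by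
  obtain ⟨β, F, hF, h⟩ := h
  exact ⟨β, F, hF, fun a ha b hb hab => hr a ha b hb (h a ha b hb hab)⟩

theorem and (h : FinDisc s r) (h' : FinDisc s r') : FinDisc s fun a b => r a b ∧ r' a b := by
  obtain ⟨β, F, hF, h⟩ := h
  obtain ⟨β', F', hF', h'⟩ := h'
  refine ⟨β × β', fun a => (F a, F' a), (hF.prod hF').subset ?_, fun a ha b hb hab => ?_⟩
  · rintro _ ⟨a, ha, rfl⟩
    exact ⟨⟨a, ha, rfl⟩, ⟨a, ha, rfl⟩⟩
  · rw [Prod.mk.injEq] at hab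
    exact ⟨h a ha b hb hab.1, h' a ha b hb hab.2⟩

theorem comap {t : Set W} (h : FinDisc s r) (f : W → V) (hf : ∀ w ∈ t, f w ∈ s) :
    FinDisc t fun a b => r (f a) (f b) := by
  obtain ⟨β, F, hF, h⟩ := h
  refine ⟨β, F ∘ f, hF.subset ?_, fun a ha b hb hab => h _ (hf a ha) _ (hf b hb) hab⟩
  rintro _ ⟨a, ha, rfl⟩
  exact ⟨f a, hf a ha, rfl⟩

theorem forall_fin {n : ℕ} {r : Fin n → V → V → Prop} (h : ∀ i, FinDisc s (r i)) :
    FinDisc s fun a b => ∀ i, r i a b := by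
  choose β F hF h using h
  refine ⟨∀ i, β i, fun a i => F i a, (Set.Finite.pi' hF).subset ?_, fun a ha b hb hab i => ?_⟩
  · rintro _ ⟨a, ha, rfl⟩ i
    exact ⟨a, ha, rfl⟩
  · exact h i a ha b hb (congrFun hab i)

theorem forall_mem_finset {ι : Type*} (t : Finset ι) {r : ι → V → V → Prop}
    (h : ∀ i ∈ t, FinDisc s (r i)) : FinDisc s fun a b => ∀ i ∈ t, r i a b := by
  refine (forall_fin fun j => h (t.equivFin.symm j) (t.equivFin.symm j).2).mono ?_
  intro a _ b _ hab i hi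
  simpa using hab (t.equivFin ⟨i, hi⟩)

theorem of_bounded (f : V → ℝ) (M : ℝ) (hf : ∀ a ∈ s, |f a| ≤ M) {ε : ℝ} (hε : 0 < ε) :
    FinDisc s fun a b => |f a - f b| ≤ ε := by
  refine ⟨ℤ, fun a => ⌊f a / ε⌋, (Set.finite_Icc ⌊-M / ε⌋ ⌊M / ε⌋).subset ?_, ?_⟩
  · rintro _ ⟨a, ha, rfl⟩
    have := abs_le.1 (hf a ha)
    exact ⟨Int.floor_mono (by gcongr; exact this.1), Int.floor_mono (by gcongr; exact this.2)⟩
  · intro a _ b _ hab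
    have h := Int.abs_sub_lt_one_of_floor_eq_floor hab
    rw [← sub_div, abs_div, abs_of_pos hε, div_lt_one hε] at h
    exact h.le

/-- A set with a finite discretization at some scale is bounded. -/
theorem exists_norm_le {N : V → ℝ} {ε : ℝ} (h : FinDisc s r)
    (hr : ∀ a ∈ s, ∀ b ∈ s, r a b → N a ≤ N b + ε) : ∃ R, 0 ≤ R ∧ ∀ a ∈ s, N a ≤ R := by
  obtain ⟨β, F, hF, h⟩ := h
  rcases s.eq_empty_or_nonempty with rfl | ⟨a₀, -⟩
  · exact ⟨0, le_rfl, by simp⟩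
  have : Nonempty V := ⟨a₀⟩
  have hc : ∀ y, y ∈ F '' s → ∃ a, a ∈ s ∧ F a = y := fun y hy => hy
  choose! g hg hFg using hc
  obtain ⟨M, hM⟩ := (hF.image fun y => N (g y) + ε).bddAbove
  refine ⟨max M 0, le_max_right _ _, fun a ha => ?_⟩
  have hy : F a ∈ F '' s := ⟨a, ha, rfl⟩
  exact ((hr a ha _ (hg _ hy) (h a ha _ (hg _ hy) (hFg _ hy).symm)).trans
    (hM ⟨_, hy, rfl⟩)).trans (le_max_left _ _)

end FinDisc

/-! ### Real subspaces of the self-adjoint part of a C*-algebra -/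

section OperatorSystem

variable {A : Type*} [CStarAlgebra A] [PartialOrder A] [StarOrderedRing A]

/-- The order bounds place the real spectrum in `[-r, r]`, and the functional calculus turns this
into a norm bound. -/
theorem norm_le_of_neg_smul_one_le {a : A} (ha : IsSelfAdjoint a) {r : ℝ} (hr : 0 ≤ r)
    (h1 : -(r • (1 : A)) ≤ a) (h2 : a ≤ r • (1 : A)) : ‖a‖ ≤ r := by
  rw [← Algebra.algebraMap_eq_smul_one, ← map_neg, algebraMap_le_iff_le_spectrum] at h1
  rw [← Algebra.algebraMap_eq_smul_one, le_algebraMap_iff_spectrum_le] at h2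
  rw [← cfc_id ℝ a]
  exact norm_cfc_le hr fun x hx => abs_le.2 ⟨h1 x hx, h2 x hx⟩

theorem le_norm_smul_one {a : A} (ha : IsSelfAdjoint a) : a ≤ ‖a‖ • (1 : A) := by
  rw [← Algebra.algebraMap_eq_smul_one]
  exact ha.le_algebraMap_norm_self

theorem neg_norm_smul_one_le {a : A} (ha : IsSelfAdjoint a) : -(‖a‖ • (1 : A)) ≤ a := by
  rw [← Algebra.algebraMap_eq_smul_one]
  exact ha.neg_algebraMap_norm_le_self

variable {V : Submodule ℝ A} (hV : ∀ a ∈ V, IsSelfAdjoint a) (h1 : (1 : A) ∈ V)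

include hV in
theorem isOrderUnitSpace : IsOrderUnitSpace (⟨1, h1⟩ : V) where
  add_le_add_left a b c h := by
    change (c : A) + a ≤ c + b
    exact add_le_add_right (show (a : A) ≤ b from h) _
  smul_nonneg r a hr ha := by
    change (0 : A) ≤ r • (a : A)
    exact smul_nonneg hr (show (0 : A) ≤ a from ha)
  order_unit a := ⟨‖(a : A)‖, le_norm_smul_one (hV a a.2)⟩
  archimedean a h := by
    change (a : A) ≤ 0
    have h2 : Filter.Tendsto (fun r : ℝ => r • (1 : A)) (nhdsWithin 0 (Set.Ioi 0)) (nhds 0) := by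
      have : Filter.Tendsto (fun r : ℝ => r • (1 : A)) (nhds 0) (nhds ((0 : ℝ) • (1 : A))) :=
        (continuous_id.smul continuous_const).tendsto 0
      rw [zero_smul] at this
      exact this.mono_left nhdsWithin_le_nhds
    refine ge_of_tendsto h2 ?_
    filter_upwards [self_mem_nhdsWithin] with r hr
    exact h r hr

include hV in
theorem ouNorm_eq_norm (a : V) : ouNorm (⟨1, h1⟩ : V) a = ‖(a : A)‖ := by
  have hmem : ‖(a : A)‖ ∈ {r : ℝ | -(r • (⟨1, h1⟩ : V)) ≤ a ∧ a ≤ r • (⟨1, h1⟩ : V)} :=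
    ⟨neg_norm_smul_one_le (hV a a.2), le_norm_smul_one (hV a a.2)⟩
  rcases subsingleton_or_nontrivial A with hA | hA
  -- In the zero algebra every real `r` is admissible, and `sInf` of all of `ℝ` is `0` by
  -- convention.
  · have : {r : ℝ | -(r • (⟨1, h1⟩ : V)) ≤ a ∧ a ≤ r • (⟨1, h1⟩ : V)} = Set.univ :=
      Set.eq_univ_of_forall fun r =>
        ⟨(Subsingleton.elim (-(r • (1 : A))) (a : A)).le,
          (Subsingleton.elim (a : A) (r • (1 : A))).le⟩
    rw [ouNorm, this, Real.sInf_univ, Subsingleton.elim (a : A) 0, norm_zero]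
  · refine IsLeast.csInf_eq ⟨hmem, fun r hr => ?_⟩
    have h2 : -(r • (1 : A)) ≤ a := hr.1
    have h3 : (a : A) ≤ r • (1 : A) := hr.2
    refine norm_le_of_neg_smul_one_le (hV a a.2) ?_ h2 h3
    by_contra! hneg
    have h4 : (0 : A) ≤ (r + r) • (1 : A) := by
      rw [add_smul]
      exact neg_le_iff_add_nonneg.1 (h2.trans h3)
    have h5 : (r + r) • (1 : A) ≤ 0 := smul_nonpos_of_nonpos_of_nonneg (by linarith) zero_le_one
    have h6 := smul_eq_zero.1 (le_antisymm h5 h4)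
    rcases h6 with h6 | h6
    · linarith
    · exact one_ne_zero h6

/-- If both norms were at most some `t < 2‖a‖`, then `±a ≤ (t - ‖a‖) • 1`, forcing `‖a‖ ≤ t - ‖a‖ <
‖a‖`. This prepares the construction of a state that attains the norm. -/
theorem norm_smul_one_add_eq {a : A} (ha : IsSelfAdjoint a) :
    ‖‖a‖ • (1 : A) + a‖ = 2 * ‖a‖ ∨ ‖‖a‖ • (1 : A) - a‖ = 2 * ‖a‖ := by
  rcases subsingleton_or_nontrivial A with hA | hA
  · left; simp [Subsingleton.elim a 0]
  have hsa : IsSelfAdjoint (‖a‖ • (1 : A)) := by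
    rw [← Algebra.algebraMap_eq_smul_one]
    exact IsSelfAdjoint.algebraMap _ (IsSelfAdjoint.all _)
  have key : ∀ b : A, ‖b‖ = ‖a‖ → ‖‖a‖ • (1 : A) + b‖ ≤ 2 * ‖a‖ := fun b hb => by
    refine (norm_add_le _ _).trans ?_
    rw [norm_smul, norm_norm, norm_one, hb]; linarith
  by_contra! h
  have k1 := lt_of_le_of_ne (key a rfl) h.1
  have k2 := lt_of_le_of_ne (key (-a) (norm_neg a)) (by rw [← sub_eq_add_neg]; exact h.2)
  rw [← sub_eq_add_neg] at k2
  have hp : (0 : ℝ) ≤ ‖‖a‖ • (1 : A) + a‖ := norm_nonneg _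
  set t := max ‖‖a‖ • (1 : A) + a‖ ‖‖a‖ • (1 : A) - a‖
  have ht : t < 2 * ‖a‖ := max_lt k1 k2
  have m1 : ‖a‖ • (1 : A) + a ≤ t • (1 : A) :=
    (le_norm_smul_one (hsa.add ha)).trans (smul_le_smul_of_nonneg_right (le_max_left _ _) zero_le_one)
  have m2 : ‖a‖ • (1 : A) - a ≤ t • (1 : A) :=
    (le_norm_smul_one (hsa.sub ha)).trans
      (smul_le_smul_of_nonneg_right (le_max_right _ _) zero_le_one)
  have m3 : a ≤ (t - ‖a‖) • (1 : A) := by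
    rw [sub_smul]; exact le_sub_iff_add_le'.2 m1
  have m4 : -((t - ‖a‖) • (1 : A)) ≤ a := by
    rw [sub_smul, neg_sub]; exact sub_le_comm.1 m2
  by_cases hneg : 0 ≤ t - ‖a‖
  · have := norm_le_of_neg_smul_one_le ha hneg m4 m3
    linarith
  · push Not at hneg
    have h4 := neg_le_iff_add_nonneg.1 (m4.trans m3)
    rw [← add_smul] at h4
    have h5 : ((t - ‖a‖) + (t - ‖a‖)) • (1 : A) ≤ 0 :=
      smul_nonpos_of_nonpos_of_nonneg (by linarith) zero_le_one
    rcases smul_eq_zero.1 (le_antisymm h5 h4) with h6 | h6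
    · linarith
    · exact one_ne_zero h6

/-- A contractive unital functional is a state. -/
def mkState (f : V →ₗ[ℝ] ℝ) (hf1 : f ⟨1, h1⟩ = 1) (hf : ∀ a : V, |f a| ≤ ‖(a : A)‖) :
    OUState (⟨1, h1⟩ : V) where
  toLinearMap := f
  map_unit := hf1
  dualNorm_eq_one := by
    refine ⟨⟨zero_le_one, fun a => ?_⟩, fun c hc => ?_⟩
    · rw [ouNorm_eq_norm hV, one_mul]
      exact hf a
    · have h := hc.2 ⟨1, h1⟩
      rw [ouNorm_eq_norm hV, hf1, abs_one] at h
      refine h.trans (mul_le_of_le_one_right hc.1 ?_)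
      rcases subsingleton_or_nontrivial A with hA | hA
      · simp [Subsingleton.elim (1 : A) 0]
      · exact norm_one.le

include hV in
theorem OUState.abs_le_norm (μ : OUState (⟨1, h1⟩ : V)) (a : V) : |μ a| ≤ ‖(a : A)‖ := by
  have h := μ.dualNorm_eq_one.1.2 a
  rwa [ouNorm_eq_norm hV, one_mul] at h

include hV in
-- A Hahn–Banach functional norming `‖b‖ • 1 + b`, with `b = ±a`, must attain both bounds `Re f(1) ≤
-- 1` and `Re f(b) ≤ ‖b‖`, because they add up to `2‖b‖`. Its real part restricts to a state.
theorem exists_state_abs_eq_norm [Nontrivial A] (a : V) :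
    ∃ μ : OUState (⟨1, h1⟩ : V), |μ a| = ‖(a : A)‖ := by
  have key : ∀ b : A, 0 < ‖b‖ → ‖‖b‖ • (1 : A) + b‖ = 2 * ‖b‖ → ∃ f : A →L[ℂ] ℂ, ‖f‖ ≤ 1 ∧
      (f 1).re = 1 ∧ (f b).re = ‖b‖ := by
    intro b hb hb2
    obtain ⟨f, hf, hfx⟩ := exists_dual_vector'' ℂ (‖b‖ • (1 : A) + b)
    have e1 : f (‖b‖ • (1 : A) + b) = (‖b‖ : ℂ) * f 1 + f b := by
      rw [map_add, ← Complex.coe_smul, map_smul, smul_eq_mul]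
    rw [e1, hb2] at hfx
    have e2 := congrArg Complex.re hfx
    rw [Complex.add_re, Complex.re_ofReal_mul] at e2
    have e3 : (f 1).re ≤ 1 := (Complex.re_le_norm _).trans
      ((f.le_of_opNorm_le hf 1).trans (by simp))
    have e4 : (f b).re ≤ ‖b‖ := (Complex.re_le_norm _).trans
      ((f.le_of_opNorm_le hf b).trans (by simp))
    have e5 : (((2 * ‖b‖ : ℝ) : ℂ)).re = 2 * ‖b‖ := Complex.ofReal_re _
    have e6 : ‖b‖ * (f 1).re + (f b).re = 2 * ‖b‖ := e2.trans e5
    have e7 : (f 1).re = 1 := by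
      refine le_antisymm e3 ?_
      by_contra! hlt
      nlinarith
    exact ⟨f, hf, e7, by rw [e7] at e6; linarith⟩
  have key2 : ∃ f : A →L[ℂ] ℂ, ‖f‖ ≤ 1 ∧ (f 1).re = 1 ∧ |(f a).re| = ‖(a : A)‖ := by
    rcases (norm_nonneg (a : A)).eq_or_lt' with h0 | h0
    -- For `a = 0` any state will do; `b = 1` provides one.
    · obtain ⟨f, hf, hf1, -⟩ := key 1 (by simp)
        (by rw [norm_one, one_smul, ← two_smul ℝ (1 : A), norm_smul]; simp)
      refine ⟨f, hf, hf1, ?_⟩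
      rw [norm_eq_zero.1 h0]; simp
    · rcases norm_smul_one_add_eq (hV a a.2) with h | h
      · obtain ⟨f, hf, hf1, hfa⟩ := key a h0 h
        exact ⟨f, hf, hf1, by rw [hfa, abs_norm]⟩
      · obtain ⟨f, hf, hf1, hfa⟩ := key (-a) (by rwa [norm_neg])
          (by rwa [norm_neg, ← sub_eq_add_neg])
        refine ⟨f, hf, hf1, ?_⟩
        rw [map_neg, norm_neg, Complex.neg_re] at hfa
        rw [← hfa, abs_eq_max_neg, max_eq_right (by linarith)]
  obtain ⟨f, hf, hf1, hfa⟩ := key2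
  let g : V →ₗ[ℝ] ℝ := Complex.reLm ∘ₗ (f.toLinearMap.restrictScalars ℝ) ∘ₗ V.subtype
  refine ⟨mkState hV h1 g hf1 fun b => ?_, hfa⟩
  exact (Complex.abs_re_le_norm _).trans ((f.le_of_opNorm_le hf b).trans (by simp))

end OperatorSystem

/-! ### Lip norms and total boundedness modulo scalars -/

section LipNorm

variable {A : Type*} [CStarAlgebra A] [PartialOrder A] [StarOrderedRing A]
  {V : Submodule ℝ A} (hV : ∀ a ∈ V, IsSelfAdjoint a) (h1 : (1 : A) ∈ V)

omit [StarOrderedRing A] in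
theorem abs_sub_le_of_rho_le {e : V} {L : Seminorm ℝ V} {μ ν : OUState e} {ε : ℝ}
    (hε : 0 ≤ ε) (h : rho L μ ν ≤ ENNReal.ofReal ε) {a : V} (ha : L a ≤ 1) :
    |μ a - ν a| ≤ ε :=
  (ENNReal.ofReal_le_ofReal_iff hε).1
    ((le_iSup₂ (f := fun (a : V) (_ : L a ≤ 1) => ENNReal.ofReal |μ a - ν a|) a ha).trans h)

omit [StarOrderedRing A] in
theorem tendsto_eval_weakStar {e : V} (μ : OUState e) (a : V) :
    Filter.Tendsto (fun ν : OUState e => ν a) (@nhds _ (weakStarTopology e) μ) (nhds (μ a)) := by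
  let := weakStarTopology e
  have h : Continuous fun ν : OUState e => ν a :=
    (continuous_apply a).comp continuous_induced_dom
  exact h.tendsto μ

include hV in
-- Banach–Alaoglu: in the product space the states form a closed subset of a compact box, cut out by
-- linearity and the value at the unit.
theorem compactSpace_weakStar :
    @CompactSpace (OUState (⟨1, h1⟩ : V)) (weakStarTopology (⟨1, h1⟩ : V)) := by
  let := weakStarTopology (⟨1, h1⟩ : V)
  have hind : Topology.IsInducing (fun (μ : OUState (⟨1, h1⟩ : V)) (a : V) => μ a) := ⟨rfl⟩
  refine ⟨hind.isCompact_iff.2 ?_⟩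
  rw [Set.image_univ]
  have hK : IsCompact (Set.pi Set.univ fun a : V => Set.Icc (-‖(a : A)‖) ‖(a : A)‖) :=
    isCompact_univ_pi fun a => isCompact_Icc
  have hlin : IsClosed (Set.range ((↑) : (V →ₗ[ℝ] ℝ) → V → ℝ)) := LinearMap.isClosed_range_coe _ _ _
  have hone : IsClosed {f : V → ℝ | f ⟨1, h1⟩ = 1} :=
    isClosed_eq (continuous_apply _) continuous_const
  convert (hK.inter_right hlin).inter_right hone using 1
  ext f
  constructor
  · rintro ⟨μ, rfl⟩
    exact ⟨⟨fun a _ => abs_le.1 (OUState.abs_le_norm hV h1 μ a), μ.toLinearMap, rfl⟩, μ.map_unit⟩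
  · rintro ⟨⟨hb, g, rfl⟩, hg⟩
    exact ⟨mkState hV h1 g hg fun a => abs_le.2 (hb a trivial), rfl⟩

/-- The convex combination `(1 - t) μ + t ν`. -/
def segmentState (μ ν : OUState (⟨1, h1⟩ : V)) (t : ℝ) (ht : t ∈ Set.Icc (0 : ℝ) 1) :
    OUState (⟨1, h1⟩ : V) :=
  mkState hV h1 ((1 - t) • μ.toLinearMap + t • ν.toLinearMap)
    (by simp [μ.map_unit, ν.map_unit])
    (fun a => by
      have hμ := OUState.abs_le_norm hV h1 μ a
      have hν := OUState.abs_le_norm hV h1 ν a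
      have ht1 : 0 ≤ 1 - t := by linarith [ht.2]
      calc |(1 - t) * μ a + t * ν a| ≤ (1 - t) * |μ a| + t * |ν a| := by
            refine (abs_add_le _ _).trans (le_of_eq ?_)
            rw [abs_mul, abs_mul, abs_of_nonneg ht1, abs_of_nonneg ht.1]
        _ ≤ (1 - t) * ‖(a : A)‖ + t * ‖(a : A)‖ :=
            add_le_add (mul_le_mul_of_nonneg_left hμ ht1) (mul_le_mul_of_nonneg_left hν ht.1)
        _ = ‖(a : A)‖ := by ring)

include hV in
-- Finiteness of `ρ_L`, which is a priori extended-valued. The states `(1 - t) μ + t ν` tend weak-*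
-- to `μ` as `t → 0`, hence also in `ρ_L`. One of them lies at distance less than `1` from `μ`, and
-- differences along the segment scale by `t`.
theorem exists_abs_sub_le {L : Seminorm ℝ V} (hL : IsLipNorm (⟨1, h1⟩ : V) L)
    (μ ν : OUState (⟨1, h1⟩ : V)) : ∃ M : ℝ, ∀ a : V, L a ≤ 1 → |ν a - μ a| ≤ M := by
  let t : ℕ → ℝ := fun n => 1 / ((n : ℝ) + 1)
  have ht : ∀ n, t n ∈ Set.Icc (0 : ℝ) 1 := fun n =>
    ⟨by positivity, by rw [div_le_one (by positivity)]; linarith [Nat.cast_nonneg (α := ℝ) n]⟩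
  have ht0 : Filter.Tendsto t Filter.atTop (nhds 0) := tendsto_one_div_add_atTop_nhds_zero_nat
  let s : ℕ → OUState (⟨1, h1⟩ : V) := fun n => segmentState hV h1 μ ν (t n) (ht n)
  have hweak : Filter.Tendsto s Filter.atTop
      (@nhds _ (weakStarTopology (⟨1, h1⟩ : V)) μ) := by
    rw [@nhds_induced, Filter.tendsto_comap_iff, tendsto_pi_nhds]
    intro a
    have h : Filter.Tendsto (fun n => (1 - t n) * μ a + t n * ν a) Filter.atTop
        (nhds ((1 - 0) * μ a + 0 * ν a)) :=
      ((tendsto_const_nhds.sub ht0).mul_const _).add (ht0.mul_const _)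
    rw [sub_zero, one_mul, zero_mul, add_zero] at h
    exact h
  rw [← hL.topology_eq] at hweak
  let := rhoMetric (⟨1, h1⟩ : V) L
  have hball : ∀ᶠ n in Filter.atTop, edist (s n) μ < 1 :=
    EMetric.tendsto_nhds.1 hweak 1 one_pos
  obtain ⟨n, hn⟩ := hball.exists
  have hn' : rho L (s n) μ ≤ ENNReal.ofReal 1 := by
    rw [ENNReal.ofReal_one]; exact hn.le
  refine ⟨(n : ℝ) + 1, fun a ha => ?_⟩
  have h := abs_sub_le_of_rho_le zero_le_one hn' ha
  have e : s n a - μ a = t n * (ν a - μ a) := by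
    change (1 - t n) * μ a + t n * ν a - μ a = _
    ring
  have htpos : 0 < (n : ℝ) + 1 := by positivity
  rw [e, abs_mul, abs_of_nonneg (ht n).1] at h
  have h2 : t n * |ν a - μ a| = |ν a - μ a| / ((n : ℝ) + 1) := by
    change 1 / ((n : ℝ) + 1) * _ = _
    ring
  rw [h2, div_le_one htpos] at h
  exact h

include hV in
/-- The unit ball of a Lip norm is totally bounded modulo scalars. -/
theorem IsLipNorm.finDisc {L : Seminorm ℝ V} (hL : IsLipNorm (⟨1, h1⟩ : V) L) {ε : ℝ}
    (hε : 0 < ε) :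
    FinDisc {a : V | L a ≤ 1} fun a b => ∃ r : ℝ, ‖(a : A) - b - r • (1 : A)‖ ≤ ε := by
  rcases subsingleton_or_nontrivial A with hA | hA
  · exact ⟨Unit, fun _ => (), Set.toFinite _, fun a _ b _ _ =>
      ⟨0, by rw [Subsingleton.elim ((a : A) - b - _) 0, norm_zero]; exact hε.le⟩⟩
  obtain ⟨μ₀, -⟩ := exists_state_abs_eq_norm hV h1 0
  have hcomp := compactSpace_weakStar hV h1
  rw [← hL.topology_eq] at hcomp
  have hε3 : 0 < ε / 3 := by positivity
  -- The state space is compact for `ρ_L`, so it has a finite `ε / 3`-net.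
  obtain ⟨t, ht⟩ : ∃ t : Finset (OUState (⟨1, h1⟩ : V)),
      ∀ μ, ∃ ν ∈ t, rho L μ ν ≤ ENNReal.ofReal (ε / 3) := by
    let := rhoMetric (⟨1, h1⟩ : V) L
    have htb := EMetric.totallyBounded_iff.1
      (isCompact_univ (X := OUState (⟨1, h1⟩ : V))).totallyBounded (ENNReal.ofReal (ε / 3))
      (ENNReal.ofReal_pos.2 hε3)
    obtain ⟨t, ht, hcov⟩ := htb
    refine ⟨ht.toFinset, fun μ => ?_⟩
    obtain ⟨ν, hν, hμν⟩ := Set.mem_iUnion₂.1 (hcov (Set.mem_univ μ))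
    exact ⟨ν, ht.mem_toFinset.2 hν, le_of_lt hμν⟩
  refine (FinDisc.forall_mem_finset t (r := fun ν a b =>
    |(ν a - μ₀ a) - (ν b - μ₀ b)| ≤ ε / 3) fun ν _ => ?_).mono fun a ha b hb hab => ?_
  · obtain ⟨M, hM⟩ := exists_abs_sub_le hV h1 hL μ₀ ν
    exact FinDisc.of_bounded (fun a => ν a - μ₀ a) M hM hε3
  -- This scalar makes `μ₀` vanish on the difference, whose norm is attained at some state `μ`.
  -- Replacing `μ` by a nearby `ν` of the net costs `ε / 3` for each of `a` and `b`, and the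
  -- recorded values of `ν - μ₀` cost the last third.
  · refine ⟨μ₀ (a - b), ?_⟩
    obtain ⟨μ, hμ⟩ := exists_state_abs_eq_norm hV h1 (a - b - μ₀ (a - b) • ⟨1, h1⟩)
    have e : ((a - b - μ₀ (a - b) • (⟨1, h1⟩ : V) : V) : A) = (a : A) - b - μ₀ (a - b) • (1 : A) :=
      rfl
    rw [← e, ← hμ]
    obtain ⟨ν, hν, hμν⟩ := ht μ
    have k1 := abs_le.1 (abs_sub_le_of_rho_le hε3.le hμν ha)
    have k2 := abs_le.1 (abs_sub_le_of_rho_le hε3.le hμν hb)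
    have k3 := abs_le.1 (hab ν hν)
    simp only [map_sub, map_smul, smul_eq_mul, μ.map_unit, mul_one]
    rw [abs_le]
    constructor <;> linarith [k1.1, k1.2, k2.1, k2.2, k3.1, k3.2]

include hV in
/-- A seminorm that vanishes exactly on the scalars and whose unit ball is totally bounded modulo
scalars is a Lip norm. -/
theorem isLipNorm_of_finDisc {L : Seminorm ℝ V}
    (h0 : ∀ a : V, L a = 0 ↔ ∃ r : ℝ, a = r • (⟨1, h1⟩ : V))
    (hd : ∀ ε : ℝ, 0 < ε → FinDisc {a : V | L a ≤ 1} fun a b =>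
      ∃ r : ℝ, ‖(a : A) - b - r • (1 : A)‖ ≤ ε) : IsLipNorm (⟨1, h1⟩ : V) L := by
  refine ⟨h0, le_antisymm ?_ ?_⟩
  -- The `ρ_L` topology is finer: evaluation at `a` is Lipschitz for `ρ_L` with constant `L a`.
  · let := rhoMetric (⟨1, h1⟩ : V) L
    rw [weakStarTopology, ← continuous_iff_le_induced]
    refine continuous_pi fun a => continuous_iff_continuousAt.2 fun μ => ?_
    by_cases ha : L a = 0
    · obtain ⟨r, rfl⟩ := (h0 a).1 ha
      have : (fun ν : OUState (⟨1, h1⟩ : V) => ν (r • (⟨1, h1⟩ : V))) = fun _ => r := by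
        funext ν
        rw [map_smul, ν.map_unit, smul_eq_mul, mul_one]
      rw [this]
      exact continuousAt_const
    · have hpos : 0 < L a := lt_of_le_of_ne (apply_nonneg L a) (Ne.symm ha)
      rw [ContinuousAt, Metric.tendsto_nhds]
      intro ε hε
      have hδ : 0 < ε / 2 / L a := by positivity
      filter_upwards [Metric.eball_mem_nhds μ (ENNReal.ofReal_pos.2 hδ)] with ν hν
      have hu : L ((L a)⁻¹ • a) ≤ 1 := by
        rw [map_smul_eq_mul, norm_inv, Real.norm_of_nonneg hpos.le, inv_mul_cancel₀ ha]
      have h := abs_sub_le_of_rho_le hδ.le (le_of_lt hν) hu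
      rw [map_smul, map_smul, smul_eq_mul, smul_eq_mul, ← mul_sub, abs_mul,
        abs_of_pos (inv_pos.2 hpos), ← div_eq_inv_mul, div_le_div_iff_of_pos_right hpos] at h
      rw [Real.dist_eq]
      linarith
  -- Conversely, closeness at one representative `g y` per value of `F` controls the whole unit
  -- ball; the scalars `r` cancel because states are unital.
  · rw [le_iff_nhds]
    intro μ
    let := rhoMetric (⟨1, h1⟩ : V) L
    refine Metric.nhds_basis_eball.ge_iff.2 fun ε hε => ?_
    obtain ⟨δ, hδ0, hδ⟩ : ∃ δ : ℝ, 0 < δ ∧ ENNReal.ofReal δ < ε := by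
      obtain ⟨δ, hδ⟩ := ENNReal.lt_iff_exists_nnreal_btwn.1 hε
      exact ⟨δ, by exact_mod_cast hδ.1, by rw [ENNReal.ofReal_coe_nnreal]; exact hδ.2⟩
    have hδ3 : 0 < δ / 3 := by positivity
    obtain ⟨β, F, hF, hr⟩ := hd (δ / 3) hδ3
    have hc : ∀ y, y ∈ F '' {a : V | L a ≤ 1} → ∃ a : V, L a ≤ 1 ∧ F a = y := fun y hy => hy
    choose! g hg hFg using hc
    have hev : ∀ᶠ ν in @nhds _ (weakStarTopology (⟨1, h1⟩ : V)) μ,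
        ∀ y ∈ F '' {a : V | L a ≤ 1}, |ν (g y) - μ (g y)| < δ / 3 := by
      rw [Filter.eventually_all_finite hF]
      intro y _
      exact Metric.tendsto_nhds.1 (tendsto_eval_weakStar μ (g y)) _ hδ3
    filter_upwards [hev] with ν hν
    refine lt_of_le_of_lt (iSup₂_le fun a ha => ENNReal.ofReal_le_ofReal ?_) hδ
    have hy : F a ∈ F '' {a : V | L a ≤ 1} := ⟨a, ha, rfl⟩
    obtain ⟨r, hr⟩ := hr a ha (g (F a)) (hg _ hy) (hFg _ hy).symm
    have k1 := (OUState.abs_le_norm hV h1 ν (a - g (F a) - r • ⟨1, h1⟩)).trans hr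
    have k2 := (OUState.abs_le_norm hV h1 μ (a - g (F a) - r • ⟨1, h1⟩)).trans hr
    have k3 := abs_lt.1 (hν _ hy)
    simp only [map_sub, map_smul, smul_eq_mul, OUState.map_unit, mul_one] at k1 k2
    rw [abs_le] at k1 k2 ⊢
    change -δ ≤ ν a - μ a ∧ ν a - μ a ≤ δ
    constructor <;> linarith [k1.1, k1.2, k2.1, k2.2, k3.1, k3.2]

end LipNorm

/-! ### Operator matrices and summable weights -/

section Matrices

variable {A H : Type*} [CStarAlgebra A]
  [NormedAddCommGroup H] [InnerProductSpace ℂ H] [CompleteSpace H]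
  {ρ : A →⋆ₐ[ℂ] (H →L[ℂ] H)}

omit [CompleteSpace H] in
/-- An operator on `ℓ²(ℕ; H)` is bounded by the sum of bounds of its matrix entries. -/
theorem opNorm_le_tsum_of_entry_le (T : HilbertL2 H →L[ℂ] HilbertL2 H) {m : ℕ × ℕ → ℝ}
    (hm0 : ∀ p, 0 ≤ m p) (hm : Summable m)
    (h : ∀ i j (v : H), ‖T (lp.single 2 j v) i‖ ≤ m (i, j) * ‖v‖) : ‖T‖ ≤ ∑' p, m p := by
  have hrow : ∀ i, Summable fun j => m (i, j) := hm.prod_factor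
  have htot : Summable fun i => ∑' j, m (i, j) := hm.prod
  have hrow0 : ∀ i, 0 ≤ ∑' j, m (i, j) := fun i => tsum_nonneg fun j => hm0 (i, j)
  refine T.opNorm_le_bound (tsum_nonneg hm0) fun x => ?_
  have hcoord : ∀ i, ‖T x i‖ ≤ (∑' j, m (i, j)) * ‖x‖ := by
    intro i
    have hs := (lp.hasSum_single (E := fun _ : ℕ => H) ENNReal.ofNat_ne_top x).mapL T
    have hs2 : HasSum (fun j => T (lp.single 2 j (x j)) i) (T x i) := by
      have hc : Continuous fun y : HilbertL2 H => y i :=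
        (continuous_apply i).comp lp.uniformContinuous_coe.continuous
      exact hs.map ((Pi.evalAddMonoidHom (fun _ : ℕ => H) i).comp
        (lp.coeFnAddMonoidHom (fun _ : ℕ => H) 2)) hc
    refine hs2.norm_le_of_bounded ((hrow i).hasSum.mul_right ‖x‖) fun j => (h i j _).trans ?_
    exact mul_le_mul_of_nonneg_left (lp.norm_apply_le_norm two_ne_zero x j) (hm0 _)
  have hM : 0 ≤ (∑' p, m p) * ‖x‖ := mul_nonneg (tsum_nonneg hm0) (norm_nonneg _)
  refine lp.norm_le_of_forall_sum_le (by norm_num) hM fun s => ?_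
  have h2 : (2 : ℝ≥0∞).toReal = ((2 : ℕ) : ℝ) := by norm_num
  simp only [h2, Real.rpow_natCast]
  -- The `ℓ²` norm of the coordinates is bounded by their `ℓ¹` norm.
  calc ∑ i ∈ s, ‖T x i‖ ^ 2 ≤ (∑ i ∈ s, ‖T x i‖) ^ 2 :=
        Finset.sum_sq_le_sq_sum_of_nonneg fun i _ => norm_nonneg _
    _ ≤ ((∑' p, m p) * ‖x‖) ^ 2 := by
        refine pow_le_pow_left₀ (Finset.sum_nonneg fun i _ => norm_nonneg _) ?_ 2
        calc ∑ i ∈ s, ‖T x i‖ ≤ ∑ i ∈ s, (∑' j, m (i, j)) * ‖x‖ :=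
              Finset.sum_le_sum fun i _ => hcoord i
          _ = (∑ i ∈ s, ∑' j, m (i, j)) * ‖x‖ := (Finset.sum_mul _ _ _).symm
          _ ≤ (∑' p, m p) * ‖x‖ := by
              rw [hm.tsum_prod]
              exact mul_le_mul_of_nonneg_right
                (htot.sum_le_tsum s fun i _ => hrow0 i) (norm_nonneg _)

theorem IsEntry.unique (hρ : Function.Injective ρ) {T : HilbertL2 H →L[ℂ] HilbertL2 H} {i j : ℕ}
    {a b : A} (ha : IsEntry ρ T i j a) (hb : IsEntry ρ T i j b) : a = b :=
  hρ (ContinuousLinearMap.ext fun v => (ha v).symm.trans (hb v))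

theorem IsEntry.add {T U : HilbertL2 H →L[ℂ] HilbertL2 H} {i j : ℕ} {a b : A}
    (ha : IsEntry ρ T i j a) (hb : IsEntry ρ U i j b) : IsEntry ρ (T + U) i j (a + b) := fun v => by
  simp only [add_apply, lp.coeFn_add, Pi.add_apply, map_add, ha v, hb v]

theorem IsEntry.smul {T : HilbertL2 H →L[ℂ] HilbertL2 H} {i j : ℕ} {a : A}
    (ha : IsEntry ρ T i j a) (c : ℂ) : IsEntry ρ (c • T) i j (c • a) := fun v => by
  simp only [smul_apply, lp.coeFn_smul, Pi.smul_apply, map_smul, ha v]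

theorem IsEntry.sub {T U : HilbertL2 H →L[ℂ] HilbertL2 H} {i j : ℕ} {a b : A}
    (ha : IsEntry ρ T i j a) (hb : IsEntry ρ U i j b) : IsEntry ρ (T - U) i j (a - b) := by
  have h := ha.add (hb.smul (-1))
  rwa [neg_one_smul, neg_one_smul, ← sub_eq_add_neg, ← sub_eq_add_neg] at h

theorem IsEntry.star {T : HilbertL2 H →L[ℂ] HilbertL2 H} {i j : ℕ} {a : A}
    (ha : IsEntry ρ T j i a) : IsEntry ρ (star T) i j (star a) := fun v => by
  refine ext_inner_right ℂ fun w => ?_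
  rw [← lp.inner_single_right (𝕜 := ℂ) (G := fun _ : ℕ => H), ContinuousLinearMap.star_eq_adjoint,
    ContinuousLinearMap.adjoint_inner_left, lp.inner_single_left, ha w, map_star,
    ContinuousLinearMap.star_eq_adjoint, ContinuousLinearMap.adjoint_inner_left]

theorem opNorm_le_tsum_of_isEntry {T : HilbertL2 H →L[ℂ] HilbertL2 H} {a : ℕ → ℕ → A}
    (ha : ∀ i j, IsEntry ρ T i j (a i j)) {m : ℕ × ℕ → ℝ} (hm : Summable m)
    (h : ∀ i j, ‖a i j‖ ≤ m (i, j)) : ‖T‖ ≤ ∑' p, m p := by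
  refine opNorm_le_tsum_of_entry_le T (fun p => (norm_nonneg _).trans (h p.1 p.2)) hm
    fun i j v => ?_
  rw [ha i j v]
  refine ((ρ (a i j)).le_opNorm v).trans (mul_le_mul_of_nonneg_right ?_ (norm_nonneg v))
  exact (NonUnitalStarAlgHom.norm_apply_le ρ (a i j)).trans (h i j)

/-- The difference has zero entries, so the entrywise norm bound applies with `m = 0`. -/
theorem eq_of_isEntry {T U : HilbertL2 H →L[ℂ] HilbertL2 H} {a : ℕ → ℕ → A}
    (hT : ∀ i j, IsEntry ρ T i j (a i j)) (hU : ∀ i j, IsEntry ρ U i j (a i j)) : T = U := by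
  have h := opNorm_le_tsum_of_isEntry (fun i j => (hT i j).sub (hU i j)) (m := 0)
    summable_zero (by simp)
  simp only [Pi.zero_apply, tsum_zero] at h
  exact sub_eq_zero.1 (norm_le_zero_iff.1 h)

/-- Both `i + 1` and `j + 1` are at most `i + j + 2`, so the terms are dominated by a product of two
series with exponent `k / 2 > 1`. -/
theorem summable_rpow_neg_add {k : ℝ} (hk : 2 < k) :
    Summable fun p : ℕ × ℕ => (((p.1 : ℝ) + (p.2 : ℝ) + 2) ^ k)⁻¹ := by
  have h1 : Summable fun n : ℕ => (((n : ℝ) + 1) ^ (k / 2))⁻¹ := by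
    have h := (summable_nat_add_iff 1).2 (Real.summable_nat_rpow_inv.2 (by linarith : 1 < k / 2))
    simpa using h
  refine Summable.of_nonneg_of_le (fun p => by positivity) (fun p => ?_)
    (h1.mul_of_nonneg h1 (fun n => by positivity) (fun n => by positivity))
  rw [← mul_inv]
  refine inv_anti₀ (by positivity) ?_
  have hp : (0 : ℝ) < (p.1 : ℝ) + (p.2 : ℝ) + 2 := by positivity
  have e : ((p.1 : ℝ) + (p.2 : ℝ) + 2) ^ k =
      ((p.1 : ℝ) + (p.2 : ℝ) + 2) ^ (k / 2) * ((p.1 : ℝ) + (p.2 : ℝ) + 2) ^ (k / 2) := by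
    rw [← Real.rpow_add hp]; ring_nf
  have h1 : (0 : ℝ) ≤ p.1 := Nat.cast_nonneg _
  have h2 : (0 : ℝ) ≤ p.2 := Nat.cast_nonneg _
  rw [e]
  gcongr <;> linarith

/-- Splits an error budget: outside `t` the tail of `m` costs at most `ε / 2`, and the other half is
shared equally among the points of `t`. -/
theorem exists_finset_tsum_ite_le {ι : Type*} {m : ι → ℝ} (hm : Summable m)
    {ε : ℝ} (hε : 0 < ε) : ∃ (t : Finset ι) (δ : ℝ), 0 < δ ∧
      ∃ m' : ι → ℝ, Summable m' ∧ ∑' p, m' p ≤ ε ∧ (∀ p ∈ t, m' p = δ) ∧ ∀ p ∉ t, m' p = m p := by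
  classical
  have h0 := (tendsto_tsum_compl_atTop_zero m).eventually (gt_mem_nhds (half_pos hε))
  obtain ⟨t, ht⟩ := h0.exists
  -- The `+ 1` avoids division by zero when `t` is empty.
  refine ⟨t, ε / 2 / (t.card + 1), by positivity,
    fun p => if p ∈ t then ε / 2 / (t.card + 1) else m p, ?_, ?_, fun p hp => if_pos hp,
    fun p hp => if_neg hp⟩
  · refine (summable_congr_cofinite ?_).2 hm
    filter_upwards [t.finite_toSet.compl_mem_cofinite] with p hp
    exact if_neg hp
  · have hs : Summable fun p => if p ∈ t then ε / 2 / ((t.card : ℝ) + 1) else m p := by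
      refine (summable_congr_cofinite ?_).2 hm
      filter_upwards [t.finite_toSet.compl_mem_cofinite] with p hp
      exact if_neg hp
    rw [← hs.sum_add_tsum_subtype_compl t, Finset.sum_congr rfl fun p hp => if_pos hp,
      tsum_congr fun p : {p // p ∉ t} => if_neg p.2, Finset.sum_const, nsmul_eq_mul]
    have : (t.card : ℝ) * (ε / 2 / (t.card + 1)) ≤ ε / 2 := by
      rw [mul_div_assoc', div_le_iff₀ (by positivity)]
      nlinarith
    linarith

end Matrices

/-! ### The seminorm `L_k` on symmetric Lipschitz matrices -/

section LipMatrices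

variable {A H : Type*} [CStarAlgebra A] [PartialOrder A] [StarOrderedRing A]
  [NormedAddCommGroup H] [InnerProductSpace ℂ H] [CompleteSpace H]
  {ρ : A →⋆ₐ[ℂ] (H →L[ℂ] H)} {S : Submodule ℝ A} {L : Seminorm ℝ S} {ν : A →ₚ[ℂ] ℂ}

omit [StarOrderedRing A] in
/-- The seminorm `L(a) + |ν(a)|`. -/
def entrySeminorm (L : Seminorm ℝ S) (ν : A →ₚ[ℂ] ℂ) : Seminorm ℝ S :=
  L + (normSeminorm ℝ ℂ).comp ((ν.toLinearMap.restrictScalars ℝ).comp S.subtype)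

omit [StarOrderedRing A] in
theorem entryWeight_eq (k : ℝ) (i j : ℕ) (a : S) :
    entryWeight L ν k i j a = ((i : ℝ) + (j : ℝ) + 2) ^ k * entrySeminorm L ν a := rfl

instance lipMatricesModule : Module ℝ (lipMatrices ρ L ν) := (lipMatrices ρ L ν).module

instance lipMatricesSMul : SMul ℝ (lipMatrices ρ L ν) := lipMatricesModule.toSMul

/-- The matrix of `x`. -/
def entries (x : lipMatrices ρ L ν) : ℕ → ℕ → S := x.2.choose

theorem isEntry_entries (x : lipMatrices ρ L ν) (i j : ℕ) :
    IsEntry ρ ((x : stabilization ρ) : HilbertL2 H →L[ℂ] HilbertL2 H) i j (entries x i j : A) :=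
  x.2.choose_spec.1 i j

theorem entries_symm (x : lipMatrices ρ L ν) (i j : ℕ) : entries x i j = entries x j i :=
  x.2.choose_spec.2.1 i j

theorem bddAbove_entryWeight (x : lipMatrices ρ L ν) (k : ℝ) :
    BddAbove (Set.range fun p : ℕ × ℕ => entryWeight L ν k p.1 p.2 (entries x p.1 p.2)) :=
  x.2.choose_spec.2.2 k

theorem lipMatrices_ext {x y : lipMatrices ρ L ν} (h : ∀ i j, entries x i j = entries y i j) :
    x = y := by
  refine Subtype.ext (Subtype.ext (eq_of_isEntry (isEntry_entries x) fun i j => ?_))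
  rw [h i j]
  exact isEntry_entries y i j

theorem entries_add (hρ : Function.Injective ρ) (x y : lipMatrices ρ L ν) (i j : ℕ) :
    entries (x + y) i j = entries x i j + entries y i j :=
  Subtype.ext ((isEntry_entries (x + y) i j).unique hρ
    ((isEntry_entries x i j).add (isEntry_entries y i j)))

theorem entries_smul (hρ : Function.Injective ρ) (r : ℝ) (x : lipMatrices ρ L ν) (i j : ℕ) :
    entries (r • x) i j = r • entries x i j :=
  Subtype.ext ((isEntry_entries (r • x) i j).unique hρ ((isEntry_entries x i j).smul (r : ℂ)))

/-- Faithfulness of `ρ` makes entries unique, so the supremum over all possible entries runs over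
the chosen ones only. -/
theorem matrixLip_eq (hρ : Function.Injective ρ) (k : ℝ) (x : lipMatrices ρ L ν) :
    matrixLip ρ L ν k (x : stabilization ρ) =
      ⨆ p : ℕ × ℕ, entryWeight L ν k p.1 p.2 (entries x p.1 p.2) := by
  rw [matrixLip, iSup]
  congr 1
  ext r
  constructor
  · rintro ⟨i, j, a, ha, rfl⟩
    refine ⟨(i, j), ?_⟩
    rw [Subtype.ext (ha.unique hρ (isEntry_entries x i j))]
  · rintro ⟨p, rfl⟩
    exact ⟨p.1, p.2, _, isEntry_entries x p.1 p.2, rfl⟩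

/-- `L_k` as a seminorm. -/
def matrixSeminorm (hρ : Function.Injective ρ) (L : Seminorm ℝ S) (ν : A →ₚ[ℂ] ℂ) (k : ℝ) :
    Seminorm ℝ (lipMatrices ρ L ν) :=
  Seminorm.of (fun x => matrixLip ρ L ν k (x : stabilization ρ))
    (fun x y => by
      simp only [matrixLip_eq hρ]
      refine ciSup_le fun p => ?_
      refine le_trans ?_ (add_le_add (le_ciSup (bddAbove_entryWeight x k) p)
        (le_ciSup (bddAbove_entryWeight y k) p))
      simp only [entryWeight_eq, entries_add hρ]
      rw [← mul_add]
      exact mul_le_mul_of_nonneg_left (map_add_le_add _ _ _) (by positivity))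
    (fun r x => by
      simp only [matrixLip_eq hρ]
      rw [Real.mul_iSup_of_nonneg (norm_nonneg r)]
      refine iSup_congr fun p => ?_
      simp only [entryWeight_eq, entries_smul hρ, map_smul_eq_mul]
      ring)

theorem matrixSeminorm_apply (hρ : Function.Injective ρ) (k : ℝ) (x : lipMatrices ρ L ν) :
    matrixSeminorm hρ L ν k x = matrixLip ρ L ν k (x : stabilization ρ) := rfl

theorem entrySeminorm_entries_le (hρ : Function.Injective ρ) (k : ℝ) (x : lipMatrices ρ L ν)
    (i j : ℕ) : ((i : ℝ) + (j : ℝ) + 2) ^ k * entrySeminorm L ν (entries x i j) ≤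
      matrixSeminorm hρ L ν k x := by
  rw [matrixSeminorm_apply, matrixLip_eq hρ]
  exact le_ciSup (bddAbove_entryWeight x k) (i, j)

theorem isSelfAdjoint_of_mem_lipMatrices (hS : ∀ a ∈ S, IsSelfAdjoint a) (x : lipMatrices ρ L ν) :
    IsSelfAdjoint (x : stabilization ρ) := by
  refine Subtype.ext (eq_of_isEntry (fun i j => ?_) (isEntry_entries x))
  have h := (isEntry_entries x j i).star
  rwa [(hS _ (entries x j i).2).star_eq, entries_symm x j i] at h

variable (h1 : (1 : A) ∈ S)

omit [StarOrderedRing A] in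
include h1 in
-- `L a = 0` leaves only scalars, and `ν (r • 1) = r` excludes the nonzero ones.
theorem entrySeminorm_eq_zero (hL : IsLipNorm (⟨1, h1⟩ : S) L) (hν : ν 1 = 1) {a : S}
    (ha : entrySeminorm L ν a = 0) : a = 0 := by
  have h : L a + ‖ν (a : A)‖ = 0 := ha
  have hL0 : L a = 0 := by linarith [apply_nonneg L a, norm_nonneg (ν (a : A))]
  have hν0 : ‖ν (a : A)‖ = 0 := by linarith
  obtain ⟨r, rfl⟩ := (hL.eq_zero_iff a).1 hL0
  have e : ν ((r • (⟨1, h1⟩ : S) : S) : A) = (r : ℂ) := by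
    change ν ((r : ℂ) • (1 : A)) = _
    rw [map_smul, hν, smul_eq_mul, mul_one]
  rw [e, norm_eq_zero, Complex.ofReal_eq_zero] at hν0
  rw [hν0, zero_smul]

include h1 in
theorem matrixSeminorm_eq_zero (hρ : Function.Injective ρ) (hL : IsLipNorm (⟨1, h1⟩ : S) L)
    (hν : ν 1 = 1) {k : ℝ} {x : lipMatrices ρ L ν} (hx : matrixSeminorm hρ L ν k x = 0) :
    x = 0 := by
  have h : ∀ y : lipMatrices ρ L ν, matrixSeminorm hρ L ν k y = 0 → ∀ i j, entries y i j = 0 := by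
    intro y hy i j
    refine entrySeminorm_eq_zero h1 hL hν (le_antisymm ?_ (apply_nonneg _ _))
    have h := entrySeminorm_entries_le hρ k y i j
    rw [hy] at h
    exact nonpos_of_mul_nonpos_right h (by positivity)
  exact lipMatrices_ext fun i j => (h x hx i j).trans (h 0 (map_zero (matrixSeminorm hρ L ν k)) i j).symm

include h1 in
/-- The unit ball of `L + |ν|` is totally bounded. -/
theorem finDisc_entrySeminorm (hS : ∀ a ∈ S, IsSelfAdjoint a) (hL : IsLipNorm (⟨1, h1⟩ : S) L)
    (hν : ν 1 = 1) {ε : ℝ} (hε : 0 < ε) :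
    FinDisc {a : S | entrySeminorm L ν a ≤ 1} fun a b => ‖(a : A) - b‖ ≤ ε := by
  obtain ⟨C, hC⟩ := PositiveLinearMap.exists_norm_apply_le ν
  have hC0 : (0 : ℝ) ≤ C := C.2
  have hA : ‖(1 : A)‖ ≤ 1 := by
    rcases subsingleton_or_nontrivial A with hA | hA
    · simp [Subsingleton.elim (1 : A) 0]
    · exact norm_one.le
  -- The error is `δ` modulo scalars plus `|r| ≤ δ + C δ`, in total `(C + 2) δ`. The bound on `r`
  -- comes from applying `ν` to `a - b - r • 1`.
  set δ : ℝ := ε / (C + 2) with hδ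
  have hδ0 : 0 < δ := by positivity
  have hδe : δ * (C + 2) = ε := by rw [hδ]; field_simp
  have d1 : FinDisc {a : S | entrySeminorm L ν a ≤ 1} fun a b =>
      ∃ r : ℝ, ‖(a : A) - b - r • (1 : A)‖ ≤ δ :=
    (IsLipNorm.finDisc hS h1 hL hδ0).comap id fun a ha => by
      have h : L a + ‖ν (a : A)‖ ≤ 1 := ha
      change L a ≤ 1
      linarith [norm_nonneg (ν (a : A))]
  have d2 : FinDisc {a : S | entrySeminorm L ν a ≤ 1} fun a b =>
      |(ν (a : A)).re - (ν (b : A)).re| ≤ δ :=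
    FinDisc.of_bounded (fun a : S => (ν (a : A)).re) 1 (fun a ha => by
      have h : L a + ‖ν (a : A)‖ ≤ 1 := ha
      linarith [Complex.abs_re_le_norm (ν (a : A)), apply_nonneg L a]) hδ0
  refine (d1.and d2).mono fun a _ b _ hab => ?_
  obtain ⟨⟨r, hr⟩, h2⟩ := hab
  have e : (ν ((a : A) - b - r • (1 : A))).re = (ν (a : A)).re - (ν (b : A)).re - r := by
    rw [← Complex.coe_smul, map_sub, map_sub, map_smul, hν]
    simp
  have h3 : |(ν (a : A)).re - (ν (b : A)).re - r| ≤ C * δ := by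
    rw [← e]
    exact (Complex.abs_re_le_norm _).trans ((hC _).trans (mul_le_mul_of_nonneg_left hr hC0))
  have h4 : |r| ≤ δ + C * δ := by
    rw [abs_le] at h2 h3 ⊢
    constructor <;> linarith [h2.1, h2.2, h3.1, h3.2]
  have h5 : ‖r • (1 : A)‖ ≤ |r| := by
    rw [norm_smul, Real.norm_eq_abs]
    exact mul_le_of_le_one_right (abs_nonneg r) hA
  calc ‖(a : A) - b‖ = ‖((a : A) - b - r • (1 : A)) + r • (1 : A)‖ := by rw [sub_add_cancel]
    _ ≤ δ + (δ + C * δ) := (norm_add_le _ _).trans (add_le_add hr (h5.trans h4))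
    _ = ε := by rw [← hδe]; ring

include h1 in
/-- For `k > 2` the unit ball of `L_k` is totally bounded in norm. -/
theorem finDisc_matrixSeminorm (hρ : Function.Injective ρ) (hS : ∀ a ∈ S, IsSelfAdjoint a)
    (hL : IsLipNorm (⟨1, h1⟩ : S) L) (hν : ν 1 = 1) {k : ℝ} (hk : 2 < k) {ε : ℝ} (hε : 0 < ε) :
    FinDisc {x : lipMatrices ρ L ν | matrixSeminorm hρ L ν k x ≤ 1} fun x y =>
      ‖(x : stabilization ρ) - (y : stabilization ρ)‖ ≤ ε := by
  -- A discretization at scale `1` already shows that the unit ball of `L + |ν|` is norm bounded.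
  obtain ⟨R, hR0, hR⟩ := (finDisc_entrySeminorm h1 hS hL hν one_pos).exists_norm_le
    (N := fun a : S => ‖(a : A)‖) (ε := 1) fun a _ b _ hab => by
      have h := norm_add_le ((a : A) - b) b
      rw [sub_add_cancel] at h
      linarith
  have hw : ∀ i j : ℕ, 1 ≤ ((i : ℝ) + (j : ℝ) + 2) ^ k := fun i j =>
    Real.one_le_rpow (by linarith [Nat.cast_nonneg (α := ℝ) i, Nat.cast_nonneg (α := ℝ) j])
      (by linarith)
  -- Entries multiplied by their weights stay in that ball, which gives the decay `hnorm`.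
  have hmem : ∀ x : lipMatrices ρ L ν, matrixSeminorm hρ L ν k x ≤ 1 → ∀ i j : ℕ,
      entrySeminorm L ν ((((i : ℝ) + (j : ℝ) + 2) ^ k) • entries x i j) ≤ 1 := by
    intro x hx i j
    rw [map_smul_eq_mul, Real.norm_of_nonneg (zero_le_one.trans (hw i j))]
    exact (entrySeminorm_entries_le hρ k x i j).trans hx
  have hball : ∀ x : lipMatrices ρ L ν, matrixSeminorm hρ L ν k x ≤ 1 → ∀ i j : ℕ,
      entrySeminorm L ν (entries x i j) ≤ 1 := fun x hx i j =>
    (le_mul_of_one_le_left (apply_nonneg _ _) (hw i j)).trans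
      ((entrySeminorm_entries_le hρ k x i j).trans hx)
  have hnorm : ∀ x : lipMatrices ρ L ν, matrixSeminorm hρ L ν k x ≤ 1 → ∀ i j : ℕ,
      ‖(entries x i j : A)‖ ≤ R * (((i : ℝ) + (j : ℝ) + 2) ^ k)⁻¹ := by
    intro x hx i j
    have h : ‖(((i : ℝ) + (j : ℝ) + 2) ^ k) • (entries x i j : A)‖ ≤ R := hR _ (hmem x hx i j)
    have hpos := zero_lt_one.trans_le (hw i j)
    rw [norm_smul, Real.norm_of_nonneg hpos.le] at h
    rwa [← div_eq_mul_inv, le_div_iff₀' hpos]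
  -- The factor `2 * R` bounds differences of two entries off `t`; on `t` the entries are
  -- discretized at scale `δ`.
  obtain ⟨t, δ, hδ, m, hm, hmε, hmt, hmc⟩ := exists_finset_tsum_ite_le
    ((summable_rpow_neg_add hk).mul_left (2 * R)) hε
  refine (FinDisc.forall_mem_finset t
    (r := fun p (x y : lipMatrices ρ L ν) =>
      ‖((entries x p.1 p.2 : S) : A) - ((entries y p.1 p.2 : S) : A)‖ ≤ δ) fun p _ =>
      (finDisc_entrySeminorm h1 hS hL hν hδ).comap (fun x : lipMatrices ρ L ν => entries x p.1 p.2)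
        fun x hx => hball x hx p.1 p.2).mono fun x hx y hy hxy => ?_
  refine (opNorm_le_tsum_of_isEntry
    (a := fun i j => ((entries x i j : S) : A) - ((entries y i j : S) : A)) (fun i j => (isEntry_entries x i j).sub (isEntry_entries y i j)) hm fun i j => ?_).trans hmε
  by_cases hp : (i, j) ∈ t
  · rw [hmt _ hp]
    exact hxy _ hp
  · rw [hmc _ hp]
    refine (norm_sub_le _ _).trans ((add_le_add (hnorm x hx i j) (hnorm y hy i j)).trans
      (le_of_eq ?_))
    ring

end LipMatrices

/-! ### Positive split extensions -/

namespace PositiveSplitExtension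

variable {J E Q : Type*} [NonUnitalCStarAlgebra J] [CStarAlgebra E] [PartialOrder E]
  [StarOrderedRing E] [CStarAlgebra Q] [PartialOrder Q] [StarOrderedRing Q]
  (X : PositiveSplitExtension J E Q)

theorem π_i (x : J) : X.π (X.i x) = 0 := (X.exact _).2 ⟨x, rfl⟩

theorem π_one : X.π 1 = 1 := by rw [← X.σ_one, X.π_σ]

/-- `b = ‖b‖ • 1 - (‖b‖ • 1 - b)` is a difference of positive elements, and `σ` preserves
positivity. -/
theorem isSelfAdjoint_σ {b : Q} (hb : IsSelfAdjoint b) : IsSelfAdjoint (X.σ b) := by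
  have h1 := X.σ.map_nonneg (sub_nonneg.2 hb.le_algebraMap_norm_self)
  have h2 := X.σ.map_nonneg
    (show (0 : Q) ≤ algebraMap ℝ Q ‖b‖ from algebraMap_nonneg Q (norm_nonneg b))
  rw [map_sub] at h1
  have h3 := (IsSelfAdjoint.of_nonneg h2).sub (IsSelfAdjoint.of_nonneg h1)
  rwa [sub_sub_cancel] at h3

theorem π_smul (r : ℝ) (a : E) : X.π (r • a) = r • X.π a := by
  rw [← Complex.coe_smul, ← Complex.coe_smul, map_smul]

theorem σ_smul (r : ℝ) (b : Q) : X.σ (r • b) = r • X.σ b := by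
  rw [← Complex.coe_smul, ← Complex.coe_smul, map_smul]

variable [Module ℝ J] [IsScalarTower ℝ ℂ J]

theorem i_smul (r : ℝ) (x : J) : X.i (r • x) = r • X.i x :=
  ((X.i : J →ₗ[ℂ] E).restrictScalars ℝ).map_smul r x

variable {W : Submodule ℝ J} {W' : Submodule ℝ Q}

theorem mem_sumSpace {a : E} :
    a ∈ X.sumSpace W W' ↔ ∃ x ∈ W, ∃ b ∈ W', X.i x + X.σ b = a := by
  rw [sumSpace, Submodule.mem_sup]
  constructor
  · rintro ⟨_, ⟨x, hx, rfl⟩, _, ⟨b, hb, rfl⟩, rfl⟩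
    exact ⟨x, hx, b, hb, rfl⟩
  · rintro ⟨x, hx, b, hb, rfl⟩
    exact ⟨_, ⟨x, hx, rfl⟩, _, ⟨b, hb, rfl⟩, rfl⟩

/-- `π` kills the range of `i` and is injective on the range of `σ`. -/
theorem disjoint_images : Disjoint (X.iImage W) (X.σImage W') := by
  rw [Submodule.disjoint_def]
  rintro _ ⟨x, _, rfl⟩ ⟨b, _, hb⟩
  have h : X.σ b = X.i x := hb
  have hb0 : b = 0 := by rw [← X.π_σ b, h, X.π_i]
  rw [hb0, map_zero] at h
  exact h.symm

theorem π_mem (a : X.sumSpace W W') : X.π a ∈ W' := by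
  obtain ⟨x, _, b, hb, h⟩ := X.mem_sumSpace.1 a.2
  rwa [← h, map_add, X.π_i, X.π_σ, zero_add]

theorem exists_i_eq (a : X.sumSpace W W') : ∃ x : W, X.i x = a - X.σ (X.π a) := by
  obtain ⟨x, hx, b, _, h⟩ := X.mem_sumSpace.1 a.2
  refine ⟨⟨x, hx⟩, ?_⟩
  rw [← h, map_add, X.π_i, X.π_σ, zero_add, add_sub_cancel_right]

/-- The component of `a` in the quotient. -/
def quotientPart : X.sumSpace W W' →ₗ[ℝ] W' where
  toFun a := ⟨X.π a, X.π_mem a⟩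
  map_add' a b := Subtype.ext (map_add X.π (a : E) b)
  map_smul' r a := Subtype.ext (X.π_smul r a)

theorem i_choose (a : X.sumSpace W W') :
    X.i ((X.exists_i_eq a).choose : J) = a - X.σ (X.π a) := (X.exists_i_eq a).choose_spec

/-- The component `i⁻¹ (a - σ (π a))` of `a` in the ideal. -/
def idealPart : X.sumSpace W W' →ₗ[ℝ] W where
  toFun a := (X.exists_i_eq a).choose
  map_add' a b := by
    -- The chosen preimage is unique because `i` is injective; linearity follows from that of `a - σ
    -- (π a)`.
    refine Subtype.ext (X.i_injective ?_)
    refine (X.i_choose (a + b)).trans ?_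
    rw [Submodule.coe_add, Submodule.coe_add, map_add X.i, i_choose, i_choose, map_add, map_add]
    abel
  map_smul' r a := by
    refine Subtype.ext (X.i_injective ?_)
    refine (X.i_choose (r • a)).trans ?_
    rw [RingHom.id_apply, Submodule.coe_smul, Submodule.coe_smul, i_smul, i_choose, π_smul, σ_smul,
      smul_sub]

theorem i_idealPart (a : X.sumSpace W W') : X.i (X.idealPart a : J) = a - X.σ (X.π a) :=
  X.i_choose a

theorem i_idealPart_add (a : X.sumSpace W W') :
    X.i (X.idealPart a : J) + X.σ (X.quotientPart a : Q) = a := by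
  rw [i_idealPart]
  exact sub_add_cancel _ _

theorem one_mem_sumSpace (h1 : (1 : Q) ∈ W') : (1 : E) ∈ X.sumSpace W W' :=
  X.mem_sumSpace.2 ⟨0, W.zero_mem, 1, h1, by rw [map_zero, zero_add, X.σ_one]⟩

theorem isSelfAdjoint_of_mem_sumSpace (hW : ∀ x ∈ W, IsSelfAdjoint x)
    (hW' : ∀ b ∈ W', IsSelfAdjoint b) : ∀ a ∈ X.sumSpace W W', IsSelfAdjoint a := by
  intro a ha
  obtain ⟨x, hx, b, hb, rfl⟩ := X.mem_sumSpace.1 ha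
  exact ((hW x hx).map X.i).add (X.isSelfAdjoint_σ (hW' b hb))

/-- The seminorm `L₂(π(a)) + N(i⁻¹(a - σ(π(a))))`. -/
def sumSeminorm (N : Seminorm ℝ W) (L₂ : Seminorm ℝ W') : Seminorm ℝ (X.sumSpace W W') :=
  L₂.comp X.quotientPart + N.comp X.idealPart

theorem sumSeminorm_apply (N : Seminorm ℝ W) (L₂ : Seminorm ℝ W') (a : X.sumSpace W W') :
    X.sumSeminorm N L₂ a = L₂ (X.quotientPart a) + N (X.idealPart a) := rfl

/-- A positive split extension of a compact quantum metric space by a space with a totally bounded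
norm is a compact quantum metric space. -/
theorem isLipNorm_sumSeminorm (hW : ∀ x ∈ W, IsSelfAdjoint x) (hW' : ∀ b ∈ W', IsSelfAdjoint b)
    (h1 : (1 : Q) ∈ W') {N : Seminorm ℝ W} (hN0 : ∀ x, N x = 0 → x = 0)
    (hN : ∀ ε : ℝ, 0 < ε → FinDisc {x : W | N x ≤ 1} fun x y => ‖(x : J) - (y : J)‖ ≤ ε)
    {L₂ : Seminorm ℝ W'} (hL₂ : IsLipNorm (⟨1, h1⟩ : W') L₂) :
    IsLipNorm (⟨1, X.one_mem_sumSpace h1⟩ : X.sumSpace W W') (X.sumSeminorm N L₂) := by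
  refine isLipNorm_of_finDisc (X.isSelfAdjoint_of_mem_sumSpace hW hW') _ (fun a => ?_)
    fun ε hε => ?_
  · have hL0 := apply_nonneg L₂ (X.quotientPart a)
    have hN0' := apply_nonneg N (X.idealPart a)
    rw [sumSeminorm_apply]
    constructor
    · intro h
      obtain ⟨r, hr⟩ := (hL₂.eq_zero_iff _).1 (by linarith : L₂ (X.quotientPart a) = 0)
      have hq := hN0 _ (by linarith : N (X.idealPart a) = 0)
      refine ⟨r, Subtype.ext ?_⟩
      rw [← X.i_idealPart_add a, hr, hq]
      change X.i 0 + X.σ (r • 1) = r • 1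
      rw [map_zero, zero_add, σ_smul, X.σ_one]
    · rintro ⟨r, rfl⟩
      have hp : X.quotientPart (r • (⟨1, X.one_mem_sumSpace h1⟩ : X.sumSpace W W')) =
          r • ⟨1, h1⟩ := by
        rw [map_smul]
        exact congrArg _ (Subtype.ext X.π_one)
      have hq : X.idealPart (⟨1, X.one_mem_sumSpace h1⟩ : X.sumSpace W W') = 0 := by
        refine Subtype.ext (X.i_injective ?_)
        rw [i_idealPart]
        change (1 : E) - X.σ (X.π 1) = X.i 0
        rw [X.π_one, X.σ_one, sub_self, map_zero]
      rw [(hL₂.eq_zero_iff _).2 ⟨r, hp⟩, map_smul, hq, smul_zero, map_zero, add_zero]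
  -- `C` bounds the norm of `σ`. The quotient scale `ε / 2 / (C + 1)` becomes at most `ε / 2` after
  -- applying `σ`, and the ideal part uses the other half.
  · obtain ⟨C, hC⟩ := PositiveLinearMap.exists_norm_apply_le X.σ
    have hC0 : (0 : ℝ) ≤ C := C.2
    have hδ : 0 < ε / 2 / (C + 1) := by positivity
    have d1 := (IsLipNorm.finDisc hW' h1 hL₂ hδ).comap
      (t := {a : X.sumSpace W W' | X.sumSeminorm N L₂ a ≤ 1}) X.quotientPart fun a ha => by
        have h : L₂ (X.quotientPart a) + N (X.idealPart a) ≤ 1 := ha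
        change L₂ (X.quotientPart a) ≤ 1
        linarith [apply_nonneg N (X.idealPart a)]
    have d2 := (hN (ε / 2) (half_pos hε)).comap
      (t := {a : X.sumSpace W W' | X.sumSeminorm N L₂ a ≤ 1}) X.idealPart fun a ha => by
        have h : L₂ (X.quotientPart a) + N (X.idealPart a) ≤ 1 := ha
        change N (X.idealPart a) ≤ 1
        linarith [apply_nonneg L₂ (X.quotientPart a)]
    refine (d1.and d2).mono fun a _ b _ hab => ?_
    obtain ⟨⟨r, hr⟩, h2⟩ := hab
    refine ⟨r, ?_⟩
    -- The scalar `r` found in the quotient also serves upstairs because `σ 1 = 1`.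
    have e : (a : E) - b - r • (1 : E) = X.i ((X.idealPart a : J) - (X.idealPart b : J)) +
        X.σ ((X.quotientPart a : Q) - (X.quotientPart b : Q) - r • (1 : Q)) := by
      have ha := X.i_idealPart_add a
      have hb := X.i_idealPart_add b
      rw [map_sub, map_sub, map_sub, σ_smul, X.σ_one]
      generalize X.i (X.idealPart a : J) = u at ha ⊢
      generalize X.σ (X.quotientPart a : Q) = v at ha ⊢
      generalize X.i (X.idealPart b : J) = u' at hb ⊢
      generalize X.σ (X.quotientPart b : Q) = v' at hb ⊢
      rw [← ha, ← hb]
      abel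
    rw [e]
    have k1 := (NonUnitalStarAlgHom.norm_apply_le X.i _).trans h2
    have k2 := (hC _).trans (mul_le_mul_of_nonneg_left hr hC0)
    have k3 : (C : ℝ) * (ε / 2 / (C + 1)) ≤ ε / 2 := by
      rw [mul_div_assoc', div_le_iff₀ (by positivity)]
      nlinarith
    exact (norm_add_le _ _).trans (by linarith)

end PositiveSplitExtension

end CQMS

end

/-! ### The main theorem -/

open CQMS in
theorem mainTheorem1
    {A H E Q : Type*}
    [CStarAlgebra A] [PartialOrder A] [StarOrderedRing A]
    [NormedAddCommGroup H] [InnerProductSpace ℂ H] [CompleteSpace H]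
    [CStarAlgebra E] [PartialOrder E] [StarOrderedRing E]
    [CStarAlgebra Q] [PartialOrder Q] [StarOrderedRing Q]
    -- the faithful representation of `A` on `H`
    (ρ : A →⋆ₐ[ℂ] (H →L[ℂ] H)) (hρ : Function.Injective ρ)
    -- the compact quantum metric space `(Lip(A), L)`, dense in the self-adjoint part of `A`
    (LipA : Submodule ℝ A)
    (hLipA : closure (LipA : Set A) = {a : A | IsSelfAdjoint a})
    (hLipA_one : (1 : A) ∈ LipA)
    (L : Seminorm ℝ LipA)
    (hL : IsCompactQuantumMetricSpace (⟨1, hLipA_one⟩ : LipA) L)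
    -- the state `ν` on `A`
    (ν : A →ₚ[ℂ] ℂ) (hν : ν 1 = 1)
    -- the extension of `Q` by `𝒦 ⊗ A`, with its positive unital splitting
    (X : PositiveSplitExtension (stabilization ρ) E Q)
    -- the compact quantum metric space `(A₂, L₂)`, dense in the self-adjoint part of `Q`
    (A₂ : Submodule ℝ Q)
    (hA₂ : closure (A₂ : Set Q) = {b : Q | IsSelfAdjoint b})
    (hA₂_one : (1 : Q) ∈ A₂)
    (L₂ : Seminorm ℝ A₂)
    (hL₂ : IsCompactQuantumMetricSpace (⟨1, hA₂_one⟩ : A₂) L₂)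
    (k : ℝ) (hk : 2 < k) :
    -- the sum `i(Ã_ν) + σ(A₂)` is direct and consists of self-adjoint elements
    Disjoint (X.iImage (lipMatrices ρ L ν)) (X.σImage A₂) ∧
    (∀ a ∈ X.sumSpace (lipMatrices ρ L ν) A₂, IsSelfAdjoint a) ∧
    ∃ (h_one : (1 : E) ∈ X.sumSpace (lipMatrices ρ L ν) A₂)
      (L₁ : Seminorm ℝ (X.sumSpace (lipMatrices ρ L ν) A₂)),
      -- `L₁(a) = L₂(π(a)) + L_k(a - σ(π(a)))`, which is well defined
      (∀ a : X.sumSpace (lipMatrices ρ L ν) A₂,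
        ∃ (hπ : X.π a ∈ A₂), ∃ x ∈ lipMatrices ρ L ν,
          X.i x = a - X.σ (X.π a) ∧
          L₁ a = L₂ ⟨X.π a, hπ⟩ + matrixLip ρ L ν k x) ∧
      -- `(A₁, L₁)` is a compact quantum metric space; in particular `L₁` is a Lip norm
      IsCompactQuantumMetricSpace
        (⟨1, h_one⟩ : X.sumSpace (lipMatrices ρ L ν) A₂) L₁ := by
  have hS : ∀ a ∈ LipA, IsSelfAdjoint a := fun a ha => by
    have h : a ∈ closure (LipA : Set A) := subset_closure ha
    rwa [hLipA] at h
  have hS₂ : ∀ b ∈ A₂, IsSelfAdjoint b := fun b hb => by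
    have h : b ∈ closure (A₂ : Set Q) := subset_closure hb
    rwa [hA₂] at h
  have hW : ∀ x ∈ lipMatrices ρ L ν, IsSelfAdjoint x := fun x hx =>
    isSelfAdjoint_of_mem_lipMatrices hS ⟨x, hx⟩
  have hsa := X.isSelfAdjoint_of_mem_sumSpace hW hS₂
  refine ⟨X.disjoint_images, hsa, X.one_mem_sumSpace hA₂_one,
    X.sumSeminorm (matrixSeminorm hρ L ν k) L₂, fun a => ?_, isOrderUnitSpace hsa _, ?_⟩
  -- The formula for `L₁` holds by definition of `sumSeminorm`, with `idealPart a` as the preimage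
  -- under `i`.
  · exact ⟨X.π_mem a, X.idealPart a, (X.idealPart a).2, X.i_idealPart a, rfl⟩
  · exact X.isLipNorm_sumSeminorm hW hS₂ hA₂_one
      (fun _ hx => matrixSeminorm_eq_zero hLipA_one hρ hL.isLipNorm hν hx)
      (fun _ hε => finDisc_matrixSeminorm hLipA_one hρ hS hL.isLipNorm hν hk hε) hL₂.isLipNorm
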